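/- Let $X$ be a preordered set (a set with a reflexive, transitive, not necessarily antisymmetric relation) which, as a thin category, is complete and cartesian closed; that is, every subset of $X$ has a greatest lower bound, and for all $x,y\in X$ there is $y^x\in X$ such that $z\le y^x$ if and only if $z\wedge x\le y$ for all $z \in X$. (If $X$ is antisymmetric, this says that $X$ is a complete Heyting algebra.) Let $\mathbf{Ord}//X$ be the category whose objects are pairs $(Y,a)$ with $Y$ a preordered set and $a\colon Y\to X$ a monotone map, and whose morphisms $f\colon (Y,a)\to(Z,b)$ are the monotone maps $f\colon Y\to Z$ with $a(y)\le b(f(y))$ for all $y\in Y$; this category has pullbacks. A morphism $f\colon A\to B$ of a category $\mathcal{C}$ with pullbacks is called an effective descent morphism (or effective for descent) if the change-of-base functor $f^*\colon \mathcal{C}/B\to\mathcal{C}/A$ is monadic. Theorem. Let $f\colon(Y,a)\to(Z,b)$ be a morphism of $\mathbf{Ord}//X$ such that for all $z_0\le z_1\le z_2$ in $Z$ there are $y_0\le y_1\le y_2$ in $Y$ with $f(y_i)=z_i$ for $i=0,1,2$ and $a(y_0)=b(z_0)$ (where, if $X$ is not antisymmetric, it is enough that $a(y_0)\le b(z_0)$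 and $b(z_0)\le a(y_0)$). Then $f$ is an effective descent morphism in $\mathbf{Ord}//X$. -/

import Mathlib

open CategoryTheory CategoryTheory.Limits

universe u

/-- A preordered set `X` which, as a (thin) category, is complete and cartesian closed, i.e. a
complete Heyting algebra up to the missing antisymmetry: every subset has a meet, and for all
`x, y` there is an exponential `e = y ^ x`, characterised by `z ≤ e ↔ z ∧ x ≤ y`
(where `z ∧ x` is any greatest lower bound of `z` and `x`). -/
class CompleteHeytingPreorder (X : Type u) [Preorder X] : Prop where
  exists_isGLB : ∀ s : Set X, ∃ m, IsGLB s m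
  exists_exponential : ∀ x y : X, ∃ e : X, ∀ z m : X, IsGLB {z, x} m → (z ≤ e ↔ m ≤ y)

/-- The objects of the lax comma category `Ord // X`: preordered sets `Y` equipped with a
monotone map `a : Y → X`. -/
structure LaxComma (X : Type u) [Preorder X] where
  /-- the underlying preordered set -/
  carrier : Type u
  [preorder : Preorder carrier]
  /-- the structure map -/
  str : carrier →o X

namespace LaxComma

attribute [instance] LaxComma.preorder

variable {X : Type u} [Preorder X]

/-- A morphism `(Y, a) ⟶ (Z, b)` of `Ord // X`: a monotone map `f : Y → Z` with `a ≤ b ∘ f`. -/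
@[ext]
structure Hom (Y Z : LaxComma X) where
  /-- the underlying monotone map -/
  map : Y.carrier →o Z.carrier
  str_le : ∀ y, Y.str y ≤ Z.str (map y)

instance : Category (LaxComma X) where
  Hom := Hom
  id Y := ⟨OrderHom.id, fun _ => le_rfl⟩
  comp f g := ⟨g.map.comp f.map, fun y => (f.str_le y).trans (g.str_le (f.map y))⟩

@[ext]
theorem hom_ext {Y Z : LaxComma X} {f g : Y ⟶ Z} (h : ∀ y, f.map y = g.map y) : f = g :=
  Hom.ext (OrderHom.ext _ _ (funext h))

@[simp]
theorem id_map {Y : LaxComma X} (y : Y.carrier) : Hom.map (𝟙 Y) y = y := rfl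

@[simp]
theorem comp_map {Y Z W : LaxComma X} (f : Y ⟶ Z) (g : Z ⟶ W) (y : Y.carrier) :
    (f ≫ g).map y = g.map (f.map y) := rfl

section Pullbacks

variable [CompleteHeytingPreorder X]

/-- A chosen binary meet in `X`. -/
noncomputable def meet (x y : X) : X :=
  (CompleteHeytingPreorder.exists_isGLB ({x, y} : Set X)).choose

theorem le_meet_iff {x y z : X} : z ≤ meet x y ↔ z ≤ x ∧ z ≤ y := by
  have h := (CompleteHeytingPreorder.exists_isGLB ({x, y} : Set X)).choose_spec
  have h' : z ≤ meet x y ↔ z ∈ lowerBounds ({x, y} : Set X) := le_isGLB_iff h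
  simpa using h'

variable {Y W Z : LaxComma X} (f : Y ⟶ Z) (g : W ⟶ Z)

/-- The pullback of `f : (Y, a) ⟶ (Z, b)` and `g : (W, c) ⟶ (Z, b)`: the set of all `(y, w)` with
`f y = g w`, ordered componentwise, with structure map `a y ∧ c w`. -/
noncomputable def pullbackObj : LaxComma X where
  carrier := {p : Y.carrier × W.carrier // f.map p.1 = g.map p.2}
  str :=
    { toFun := fun p => meet (Y.str p.1.1) (W.str p.1.2)
      monotone' := fun _ _ h => le_meet_iff.2
        ⟨(le_meet_iff.1 le_rfl).1.trans (Y.str.monotone h.1),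
          (le_meet_iff.1 le_rfl).2.trans (W.str.monotone h.2)⟩ }

/-- The first projection. -/
noncomputable def pullbackFst : pullbackObj f g ⟶ Y where
  map := { toFun := fun p => p.1.1, monotone' := fun _ _ h => h.1 }
  str_le _ := (le_meet_iff.1 le_rfl).1

/-- The second projection. -/
noncomputable def pullbackSnd : pullbackObj f g ⟶ W where
  map := { toFun := fun p => p.1.2, monotone' := fun _ _ h => h.2 }
  str_le _ := (le_meet_iff.1 le_rfl).2

theorem pullback_condition : pullbackFst f g ≫ f = pullbackSnd f g ≫ g :=
  hom_ext fun p => p.2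

/-- The morphism into the pullback induced by a commutative square. -/
noncomputable def pullbackLift {T : LaxComma X} (h : T ⟶ Y) (k : T ⟶ W) (w : h ≫ f = k ≫ g) :
    T ⟶ pullbackObj f g where
  map :=
    { toFun := fun t =>
        ⟨(h.map t, k.map t), congrArg (fun m : T ⟶ Z => m.map t) w⟩
      monotone' := fun _ _ e => ⟨h.map.monotone e, k.map.monotone e⟩ }
  str_le t := le_meet_iff.2 ⟨h.str_le t, k.str_le t⟩

theorem isPullback_pullbackObj : IsPullback (pullbackFst f g) (pullbackSnd f g) f g where
  w := pullback_condition f g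
  isLimit' := ⟨PullbackCone.IsLimit.mk _
    (fun s => pullbackLift f g s.fst s.snd s.condition)
    (fun _ => rfl) (fun _ => rfl)
    (fun s _ h₁ h₂ => hom_ext fun t => Subtype.ext (Prod.ext
      (congrArg (fun n : s.pt ⟶ Y => n.map t) h₁)
      (congrArg (fun n : s.pt ⟶ W => n.map t) h₂)))⟩

instance : HasPullbacks (LaxComma X) :=
  haveI : ∀ {Y W Z : LaxComma X} {f : Y ⟶ Z} {g : W ⟶ Z}, HasLimit (cospan f g) :=
    fun {_ _ _ f g} => (isPullback_pullbackObj f g).hasPullback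
  hasPullbacks_of_hasLimit_cospan _

end Pullbacks

end LaxComma

/-- A morphism `f : Y ⟶ Z` of a category `C` with pullbacks is an effective descent morphism
(is effective for descent) if the change-of-base functor `f^* : C/Z ⥤ C/Y` is monadic: the
comparison functor from `C/Z` to the category of algebras of the monad on `C/Y` induced by the
adjunction `f_! ⊣ f^*` is an equivalence of categories. -/
def IsEffectiveDescent {C : Type*} [Category C] [HasPullbacks C] {Y Z : C} (f : Y ⟶ Z) : Prop :=
  (Monad.comparison (Over.mapPullbackAdj f)).IsEquivalence

/-!
Write `θ(w, y)` for the action of an algebra of the monad induced by `f_! ⊣ f^*`: such an algebra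
is an object `p : W ⟶ Y` over `Y` with a morphism `θ : W ×_Z Y ⟶ W`, defined on the pairs with
`f (p w) = f y`, such that `p θ(w, y) = y`, `θ(w, p w) = w` and `θ(θ(w, y), y') = θ(w, y')`.
Thus `θ` transports `w` along the fibres of `f` (`transport`).

*Full faithfulness.* For `B` and `B'` over `Z`, a morphism of algebras `f^* B ⟶ f^* B'` commutes
with transport, hence has the form `(w, y) ↦ (v w, y)` with `v w` independent of `y`. Lifting
`z₀ ≤ z₁` to `Y` makes `v` monotone, and evaluating at a `y` over the image of `w` with
`b (f y) ≤ a y` gives the inequality of structure maps; see `comparison_full`. It is faithful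
because `f` is surjective.

*Essential surjectivity.* Choose `s : Z → Y` with `f (s z) = z` and `b z ≤ a (s z)`. The elements
`w` with `p w = s (f (p w))` form a set of representatives for the orbits of the transport, with
`w ↦ θ(w, s (f (p w)))` as the quotient map. Order them by `w ≤ w'` if some transports of `w` and
`w'` are related in `W`. Liftings of two-step chains show that this relation is transitive
(`DescentLE.trans`); the equivalence of `a y₀` and `b z₀` shows that the restriction of the
structure map of `W` is monotone for it (`DescentLE.str_le`). The resulting object over `Z`
(`descentOver`) pulls back to `W`, by `(w, y) ↦ θ(w, y)` with inverse
`w ↦ (θ(w, s (f (p w))), p w)` (`descentIso`). Since the representatives lie over the points `s z`,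
where `a (s z)` and `b z` are equivalent, no joins are needed to define the structure map, and
binary meets suffice on the side of `X`.
-/

/-! ### The components of the adjunction between composition and change of base -/

section ChangeOfBase

variable {C : Type*} [Category* C] [HasPullbacks C] {Y Z : C} (f : Y ⟶ Z)

theorem mapPullbackAdj_unit_left_fst (A : Over Y) :
    ((Over.mapPullbackAdj f).unit.app A).left ≫ pullback.fst (A.hom ≫ f) f = 𝟙 A.left := by
  rw [Over.mapPullbackAdj_unit_app]
  exact pullback.lift_fst _ _ _

theorem mapPullbackAdj_unit_left_snd (A : Over Y) :
    ((Over.mapPullbackAdj f).unit.app A).left ≫ pullback.snd (A.hom ≫ f) f = A.hom := by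
  rw [Over.mapPullbackAdj_unit_app]
  exact pullback.lift_snd _ _ _

theorem mapPullbackAdj_counit_left (B : Over Z) :
    ((Over.mapPullbackAdj f).counit.app B).left = pullback.fst B.hom f := by
  rw [Over.mapPullbackAdj_counit_app]
  rfl

theorem pullback_map_left_fst {A B : Over Z} (g : A ⟶ B) :
    ((Over.pullback f).map g).left ≫ pullback.fst B.hom f = pullback.fst A.hom f ≫ g.left :=
  pullback.lift_fst _ _ _

theorem pullback_map_left_snd {A B : Over Z} (g : A ⟶ B) :
    ((Over.pullback f).map g).left ≫ pullback.snd B.hom f = pullback.snd A.hom f :=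
  pullback.lift_snd _ _ _

end ChangeOfBase

/-! ### Elements of objects and chain liftings -/

namespace LaxComma

variable {X : Type u} [Preorder X]

theorem congr_map {Y Z : LaxComma X} {f g : Y ⟶ Z} (h : f = g) (y : Y.carrier) :
    f.map y = g.map y := by rw [h]

theorem hom_str_le {Y Z : LaxComma X} (f : Y ⟶ Z) (y : Y.carrier) :
    Y.str y ≤ Z.str (f.map y) := Hom.str_le f y

theorem hom_mono {Y Z : LaxComma X} (f : Y ⟶ Z) {y y' : Y.carrier} (h : y ≤ y') :
    f.map y ≤ f.map y' := f.map.monotone h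

theorem over_hom_apply {U : LaxComma X} {A B : Over U} (g : A ⟶ B) (w : A.left.carrier) :
    B.hom.map (g.left.map w) = A.hom.map w := congr_map (Over.w g) w

/-- Chains `z₀ ≤ z₁ ≤ z₂` lift along `f : (Y, a) ⟶ (Z, b)` to chains `y₀ ≤ y₁ ≤ y₂` such that
`a y₀` and `b z₀` are equivalent. -/
def LiftsChains {Y Z : LaxComma X} (f : Y ⟶ Z) : Prop :=
  ∀ z₀ z₁ z₂ : Z.carrier, z₀ ≤ z₁ → z₁ ≤ z₂ →
    ∃ y₀ y₁ y₂ : Y.carrier, y₀ ≤ y₁ ∧ y₁ ≤ y₂ ∧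
      f.map y₀ = z₀ ∧ f.map y₁ = z₁ ∧ f.map y₂ = z₂ ∧
      AntisymmRel (· ≤ ·) (Y.str y₀) (Z.str z₀)

/-- A set-theoretic section of `f` (not monotone in general) along which the structure map does
not drop. -/
theorem LiftsChains.exists_section {Y Z : LaxComma X} {f : Y ⟶ Z} (hf : LiftsChains f) :
    ∃ s : Z.carrier → Y.carrier, (∀ z, f.map (s z) = z) ∧ ∀ z, Z.str z ≤ Y.str (s z) := by
  have h : ∀ z, ∃ y, f.map y = z ∧ Z.str z ≤ Y.str y := fun z => by
    obtain ⟨y, -, -, -, -, hy, -, -, hs⟩ := hf z z z le_rfl le_rfl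
    exact ⟨y, hy, hs.2⟩
  choose s hs using h
  exact ⟨s, fun z => (hs z).1, fun z => (hs z).2⟩

variable [CompleteHeytingPreorder X]

/-! ### Elements of pullbacks -/

section PullbackElements

variable {Y W Z : LaxComma X} (f : Y ⟶ Z) (g : W ⟶ Z)

/-- The element of the pullback chosen by `HasPullbacks` that is given by a pair of elements with
the same image. -/
noncomputable def pullbackMk (y : Y.carrier) (w : W.carrier) (h : f.map y = g.map w) :
    (pullback f g).carrier :=
  (isPullback_pullbackObj f g).isoPullback.hom.map ⟨(y, w), h⟩

variable {f g}

@[simp]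
theorem fst_pullbackMk (y : Y.carrier) (w : W.carrier) (h : f.map y = g.map w) :
    (pullback.fst f g).map (pullbackMk f g y w h) = y :=
  congr_map (isPullback_pullbackObj f g).isoPullback_hom_fst ⟨(y, w), h⟩

@[simp]
theorem snd_pullbackMk (y : Y.carrier) (w : W.carrier) (h : f.map y = g.map w) :
    (pullback.snd f g).map (pullbackMk f g y w h) = w :=
  congr_map (isPullback_pullbackObj f g).isoPullback_hom_snd ⟨(y, w), h⟩

theorem pullback_eq {p q : (pullback f g).carrier}
    (h₁ : (pullback.fst f g).map p = (pullback.fst f g).map q)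
    (h₂ : (pullback.snd f g).map p = (pullback.snd f g).map q) : p = q := by
  have hi : ∀ r, ((isPullback_pullbackObj f g).isoPullback.hom).map
      (((isPullback_pullbackObj f g).isoPullback.inv).map r) = r := fun r =>
    congr_map (isPullback_pullbackObj f g).isoPullback.inv_hom_id r
  rw [← hi p, ← hi q]
  congr 1
  refine Subtype.ext (Prod.ext ?_ ?_)
  · exact (congr_map (isPullback_pullbackObj f g).isoPullback_inv_fst p).trans
      (h₁.trans (congr_map (isPullback_pullbackObj f g).isoPullback_inv_fst q).symm)
  · exact (congr_map (isPullback_pullbackObj f g).isoPullback_inv_snd p).trans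
      (h₂.trans (congr_map (isPullback_pullbackObj f g).isoPullback_inv_snd q).symm)

theorem pullbackMk_eta (p : (pullback f g).carrier) :
    pullbackMk f g ((pullback.fst f g).map p) ((pullback.snd f g).map p)
      (congr_map pullback.condition p) = p :=
  pullback_eq (fst_pullbackMk _ _ _) (snd_pullbackMk _ _ _)

theorem pullbackMk_congr {y y' : Y.carrier} {w w' : W.carrier} {h : f.map y = g.map w}
    {h' : f.map y' = g.map w'} (hy : y = y') (hw : w = w') :
    pullbackMk f g y w h = pullbackMk f g y' w' h' := by
  subst hy hw; rfl

theorem pullbackMk_le {y y' : Y.carrier} {w w' : W.carrier} {h : f.map y = g.map w}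
    {h' : f.map y' = g.map w'} (hy : y ≤ y') (hw : w ≤ w') :
    pullbackMk f g y w h ≤ pullbackMk f g y' w' h' :=
  hom_mono (isPullback_pullbackObj f g).isoPullback.hom (show _ ∧ _ from ⟨hy, hw⟩)

theorem le_str_pullbackMk {y : Y.carrier} {w : W.carrier} {h : f.map y = g.map w} {x : X}
    (hy : x ≤ Y.str y) (hw : x ≤ W.str w) : x ≤ (pullback f g).str (pullbackMk f g y w h) :=
  (le_meet_iff.2 ⟨hy, hw⟩).trans
    (hom_str_le (isPullback_pullbackObj f g).isoPullback.hom ⟨(y, w), h⟩)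

theorem map_fst_eq_map_snd (p : (pullback f g).carrier) :
    f.map ((pullback.fst f g).map p) = g.map ((pullback.snd f g).map p) :=
  congr_map pullback.condition p

end PullbackElements

/-! ### Algebras as actions by transport along the fibres -/

section DescentData

variable {Y Z : LaxComma X} {f : Y ⟶ Z}

theorem fst_pullback_map {A B : Over Z} (g : A ⟶ B) (p : (pullback A.hom f).carrier) :
    (pullback.fst B.hom f).map (((Over.pullback f).map g).left.map p) =
      g.left.map ((pullback.fst A.hom f).map p) :=
  congr_map (pullback_map_left_fst f g) p

theorem snd_pullback_map {A B : Over Z} (g : A ⟶ B) (p : (pullback A.hom f).carrier) :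
    (pullback.snd B.hom f).map (((Over.pullback f).map g).left.map p) =
      (pullback.snd A.hom f).map p :=
  congr_map (pullback_map_left_snd f g) p

theorem pullback_map_pullbackMk {A B : Over Z} (g : A ⟶ B) (w : A.left.carrier) (y : Y.carrier)
    (h : A.hom.map w = f.map y) :
    ((Over.pullback f).map g).left.map (pullbackMk A.hom f w y h) =
      pullbackMk B.hom f (g.left.map w) y ((over_hom_apply g w).trans h) := by
  refine pullback_eq (f := B.hom) (g := f) ?_ ?_
  · rw [fst_pullback_map, fst_pullbackMk, fst_pullbackMk]
  · rw [snd_pullback_map, snd_pullbackMk, snd_pullbackMk]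

variable (A : (Over.mapPullbackAdj f).toMonad.Algebra)

/-- The value `θ(w, y)` of the structure morphism of an algebra for the monad of change of base
along `f`: the transport of `w` to the point `y` in the same fibre of `f`. -/
noncomputable def transport (w : A.A.left.carrier) (y : Y.carrier)
    (h : f.map (A.A.hom.map w) = f.map y) : A.A.left.carrier :=
  A.a.left.map (pullbackMk (A.A.hom ≫ f) f w y h)

variable {A}

theorem hom_transport (w : A.A.left.carrier) (y : Y.carrier)
    (h : f.map (A.A.hom.map w) = f.map y) : A.A.hom.map (transport A w y h) = y :=
  (over_hom_apply A.a _).trans (snd_pullbackMk (f := A.A.hom ≫ f) (g := f) w y h)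

/-- The unit law of the algebra, on elements. -/
theorem transport_self (w : A.A.left.carrier) : transport A w (A.A.hom.map w) rfl = w := by
  refine Eq.trans ?_ (congr_map (congrArg CommaMorphism.left A.unit) w)
  refine congrArg (fun t => A.a.left.map t) (pullback_eq (f := A.A.hom ≫ f) (g := f) ?_ ?_)
  · exact (fst_pullbackMk (f := A.A.hom ≫ f) (g := f) _ _ _).trans
      (congr_map (mapPullbackAdj_unit_left_fst f A.A) w).symm
  · exact (snd_pullbackMk (f := A.A.hom ≫ f) (g := f) _ _ _).trans
      (congr_map (mapPullbackAdj_unit_left_snd f A.A) w).symm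

/-- The associativity law of the algebra, on elements. -/
theorem transport_transport (w : A.A.left.carrier) (y y' : Y.carrier)
    (h : f.map (A.A.hom.map w) = f.map y)
    (h' : f.map (A.A.hom.map (transport A w y h)) = f.map y') :
    transport A (transport A w y h) y' h' =
      transport A w y' (h.trans ((congrArg f.map (hom_transport w y h)).symm.trans h')) := by
  -- Both sides of the associativity law are evaluated at the element `((w, y), y')`.
  let T := (Over.map f).obj A.A
  let TT := (Over.map f).obj ((Over.pullback f).obj T)
  have hy : f.map y = f.map y' := (congrArg f.map (hom_transport w y h)).symm.trans h'
  let q : (pullback TT.hom f).carrier := pullbackMk TT.hom f (pullbackMk T.hom f w y h) y'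
    ((congrArg f.map (snd_pullbackMk (f := T.hom) (g := f) w y h)).trans hy)
  have e := congr_map (congrArg CommaMorphism.left A.assoc) q
  refine Eq.trans (congrArg (fun t => A.a.left.map t) ?_)
    (e.symm.trans (congrArg (fun t => A.a.left.map t) ?_))
  · exact (pullback_map_pullbackMk ((Over.map f).map A.a) _ y' _).symm
  · refine (pullback_map_pullbackMk ((Over.mapPullbackAdj f).counit.app T) _ y' _).trans ?_
    exact pullbackMk_congr ((congr_map (mapPullbackAdj_counit_left f T) _).trans
      (fst_pullbackMk (f := T.hom) (g := f) w y h)) rfl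

theorem transport_congr {w w' : A.A.left.carrier} {y y' : Y.carrier}
    {h : f.map (A.A.hom.map w) = f.map y} {h' : f.map (A.A.hom.map w') = f.map y'}
    (hw : w = w') (hy : y = y') : transport A w y h = transport A w' y' h' := by
  subst hw hy; rfl

theorem algebraHom_transport {A B : (Over.mapPullbackAdj f).toMonad.Algebra} (φ : A ⟶ B)
    (w : A.A.left.carrier) (y : Y.carrier) (h : f.map (A.A.hom.map w) = f.map y) :
    φ.f.left.map (transport A w y h) =
      transport B (φ.f.left.map w) y ((congrArg f.map (over_hom_apply φ.f w)).trans h) := by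
  refine (congr_map (congrArg CommaMorphism.left φ.h)
    (pullbackMk (A.A.hom ≫ f) f w y h)).symm.trans ?_
  exact congrArg (fun t => B.a.left.map t)
    (pullback_map_pullbackMk ((Over.map f).map φ.f) w y h)

/-- On `f^* B` the transport of `(w, y)` to `y'` is `(w, y')`. -/
theorem transport_comparison (B : Over Z)
    (p : (pullback B.hom f).carrier) (y : Y.carrier)
    (h : f.map ((pullback.snd B.hom f).map p) = f.map y) :
    transport ((Monad.comparison (Over.mapPullbackAdj f)).obj B) p y h =
      pullbackMk B.hom f ((pullback.fst B.hom f).map p) y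
        ((map_fst_eq_map_snd p).trans h) := by
  refine (pullback_map_pullbackMk ((Over.mapPullbackAdj f).counit.app B) p y h).trans ?_
  exact pullbackMk_congr (congr_map (mapPullbackAdj_counit_left f B) p) rfl

/-- A morphism over `Y` that commutes with transport is a morphism of algebras. -/
theorem algebraHom_condition {A B : (Over.mapPullbackAdj f).toMonad.Algebra} (φ : A.A ⟶ B.A)
    (hφ : ∀ w y h, φ.left.map (transport A w y h) =
      transport B (φ.left.map w) y ((congrArg f.map (over_hom_apply φ w)).trans h)) :
    ((Over.mapPullbackAdj f).toMonad : Over Y ⥤ Over Y).map φ ≫ B.a = A.a ≫ φ := by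
  refine Over.OverMorphism.ext (hom_ext fun (q : (pullback (A.A.hom ≫ f) f).carrier) => ?_)
  rw [← pullbackMk_eta (f := A.A.hom ≫ f) (g := f) q]
  refine Eq.trans ?_ (hφ _ _ (map_fst_eq_map_snd q)).symm
  exact congrArg (fun t => B.a.left.map t)
    (pullback_map_pullbackMk ((Over.map f).map φ) _ _ _)

theorem transport_le {w w' : A.A.left.carrier} {y y' : Y.carrier}
    {h : f.map (A.A.hom.map w) = f.map y} {h' : f.map (A.A.hom.map w') = f.map y'}
    (hw : w ≤ w') (hy : y ≤ y') : transport A w y h ≤ transport A w' y' h' :=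
  hom_mono A.a.left (pullbackMk_le hw hy)

theorem le_str_transport {w : A.A.left.carrier} {y : Y.carrier}
    {h : f.map (A.A.hom.map w) = f.map y} {x : X} (hw : x ≤ A.A.left.str w) (hy : x ≤ Y.str y) :
    x ≤ A.A.left.str (transport A w y h) :=
  (le_str_pullbackMk hw hy).trans (hom_str_le A.a.left _)

end DescentData

/-! ### The comparison functor is fully faithful -/

section Comparison

variable {Y Z : LaxComma X} {f : Y ⟶ Z}

theorem comparison_faithful (hf : LiftsChains f) :
    (Monad.comparison (Over.mapPullbackAdj f)).Faithful where
  map_injective {B B'} g g' h := by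
    obtain ⟨s, hs, -⟩ := hf.exists_section
    refine Over.OverMorphism.ext (hom_ext fun w => ?_)
    let p := pullbackMk B.hom f w (s (B.hom.map w)) (hs _).symm
    have e : ((Over.pullback f).map g).left.map p = ((Over.pullback f).map g').left.map p :=
      congr_map (congrArg (fun k => k.f.left) h) p
    have e' := congrArg (pullback.fst B'.hom f).map e
    simpa only [p, fst_pullback_map, fst_pullbackMk] using e'

theorem comparison_full (hf : LiftsChains f) :
    (Monad.comparison (Over.mapPullbackAdj f)).Full where
  map_surjective {B B'} φ := by
    obtain ⟨s, hs, hb⟩ := hf.exists_section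
    -- `φ.f.left`, with its source and target displayed as the chosen pullbacks.
    let φ' : pullback B.hom f ⟶ pullback B'.hom f := φ.f.left
    have hφsnd : ∀ p, (pullback.snd B'.hom f).map (φ'.map p) = (pullback.snd B.hom f).map p :=
      over_hom_apply φ.f
    let v : B.left.carrier → B'.left.carrier := fun w =>
      (pullback.fst B'.hom f).map (φ'.map (pullbackMk B.hom f w (s (B.hom.map w)) (hs _).symm))
    -- Compatibility with transport makes the `B'`-component of `φ` independent of `y`.
    have hv : ∀ w y h, φ'.map (pullbackMk B.hom f w y h) =
        pullbackMk B'.hom f (v w) y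
          ((map_fst_eq_map_snd _).trans ((congrArg f.map ((hφsnd _).trans
            (snd_pullbackMk _ _ _))).trans ((hs _).trans h))) := fun w y h => by
      have hy : f.map ((pullback.snd B.hom f).map
          (pullbackMk B.hom f w (s (B.hom.map w)) (hs _).symm)) = f.map y := by
        rw [snd_pullbackMk, hs, h]
      exact (congrArg φ'.map (pullbackMk_congr (fst_pullbackMk _ _ _).symm rfl)).trans
        ((congrArg φ'.map (transport_comparison B _ y hy)).symm.trans
          ((algebraHom_transport φ _ y hy).trans (transport_comparison B' _ y _)))
    have hv' : ∀ w y h, (pullback.fst B'.hom f).map (φ'.map (pullbackMk B.hom f w y h)) = v w :=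
      fun w y h => by rw [hv, fst_pullbackMk]
    let k : B.left ⟶ B'.left :=
      { map :=
          { toFun := v
            monotone' := fun w w' h => by
              obtain ⟨y, y', -, hy, -, hy₀, hy₁, -, -⟩ := hf _ _ _ (hom_mono B.hom h) le_rfl
              rw [← hv' w y hy₀.symm, ← hv' w' y' hy₁.symm]
              exact hom_mono _ (hom_mono _ (pullbackMk_le h hy)) }
        -- `B.left.str w ≤ Z.str z ≤ Y.str (s z)` for `z = B.hom w`, so nothing is lost in passing
        -- from `w` to the element `(w, s z)` of the pullback.
        str_le := fun w => (le_str_pullbackMk le_rfl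
          ((hom_str_le B.hom w).trans (hb _))).trans
            ((hom_str_le φ' _).trans (hom_str_le (pullback.fst B'.hom f) _)) }
    refine ⟨Over.homMk k (hom_ext fun w => ?_), ?_⟩
    · refine (map_fst_eq_map_snd _).trans ?_
      rw [hφsnd, snd_pullbackMk, hs]
    · refine Monad.Algebra.Hom.ext (Over.OverMorphism.ext (hom_ext fun p => ?_))
      rw [← pullbackMk_eta (f := B.hom) (g := f) p]
      refine (pullback_map_pullbackMk _ _ _ _).trans ?_
      exact (hv _ _ (map_fst_eq_map_snd p)).symm

end Comparison

/-! ### Descending an algebra to an object over the base -/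

section Descent

variable {Y Z : LaxComma X} {f : Y ⟶ Z}

variable (A : (Over.mapPullbackAdj f).toMonad.Algebra) (hf : LiftsChains f)
  (s : Z.carrier → Y.carrier) (hs : ∀ z, f.map (s z) = z) (hb : ∀ z, Z.str z ≤ Y.str (s z))

theorem map_hom_transport (w : A.A.left.carrier) (y : Y.carrier)
    (h : f.map (A.A.hom.map w) = f.map y) :
    f.map (A.A.hom.map (transport A w y h)) = f.map (A.A.hom.map w) :=
  (congrArg f.map (hom_transport w y h)).trans h.symm

/-- Some transport of `w` lies below some transport of `w'`. This is the order of the descended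
object; by `DescentLE.transport_le` it gives `θ(w, y) ≤ θ(w', y')` whenever `y ≤ y'`. -/
def DescentLE (w w' : A.A.left.carrier) : Prop :=
  ∃ y y' h h', transport A w y h ≤ transport A w' y' h'

variable {A}

theorem DescentLE.transport_le {w w' : A.A.left.carrier} (e : DescentLE A w w') {y y' : Y.carrier}
    (hy : y ≤ y') (h : f.map (A.A.hom.map w) = f.map y) (h' : f.map (A.A.hom.map w') = f.map y') :
    transport A w y h ≤ transport A w' y' h' := by
  obtain ⟨u, u', k, k', e⟩ := e
  rw [← transport_transport w u y k ((map_hom_transport A w u k).trans h),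
    ← transport_transport w' u' y' k' ((map_hom_transport A w' u' k').trans h')]
  exact LaxComma.transport_le e hy

theorem DescentLE.map_le {w w' : A.A.left.carrier} (e : DescentLE A w w') :
    f.map (A.A.hom.map w) ≤ f.map (A.A.hom.map w') := by
  obtain ⟨u, u', k, k', e⟩ := e
  rw [← map_hom_transport A w u k, ← map_hom_transport A w' u' k']
  exact hom_mono f (hom_mono A.A.hom e)

include hf in
theorem DescentLE.trans {w₀ w₁ w₂ : A.A.left.carrier} (e : DescentLE A w₀ w₁)
    (e' : DescentLE A w₁ w₂) : DescentLE A w₀ w₂ := by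
  obtain ⟨y₀, y₁, y₂, h₀₁, h₁₂, h₀, h₁, h₂, -⟩ := hf _ _ _ e.map_le e'.map_le
  exact ⟨y₀, y₂, h₀.symm, h₂.symm,
    (e.transport_le h₀₁ h₀.symm h₁.symm).trans (e'.transport_le h₁₂ h₁.symm h₂.symm)⟩

theorem descentLE_of_le {w w' : A.A.left.carrier} (h : w ≤ w') : DescentLE A w w' :=
  ⟨_, _, rfl, rfl, transport_le h (hom_mono A.A.hom h)⟩

theorem str_le_base_str (w : A.A.left.carrier) :
    A.A.left.str w ≤ Z.str (f.map (A.A.hom.map w)) :=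
  hom_str_le (A.A.hom ≫ f) w

include hf hb in
/-- The structure map is monotone for `DescentLE` at representatives `w'`. The value at `w` does
not decrease under transport to a point `y` with `b (f y) ≤ a y`; this is applied along a lifting
`y ≤ y'` of the images of `w` and `w'`, and once more from `θ(w', y')` back to `w'`. -/
theorem DescentLE.str_le {w w' : A.A.left.carrier} (e : DescentLE A w w')
    (hw' : s (f.map (A.A.hom.map w')) = A.A.hom.map w') : A.A.left.str w ≤ A.A.left.str w' := by
  obtain ⟨y, y', -, hy, -, h, h', -, hs⟩ := hf _ _ _ e.map_le le_rfl
  have h₁ : A.A.left.str w ≤ A.A.left.str (transport A w' y' h'.symm) :=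
    (le_str_transport le_rfl ((str_le_base_str w).trans hs.2)).trans
      (A.A.left.str.monotone (e.transport_le hy h.symm h'.symm))
  refine h₁.trans ?_
  have h₂ : transport A (transport A w' y' h'.symm) (A.A.hom.map w')
      (map_hom_transport A w' y' h'.symm) = w' :=
    (transport_transport _ _ _ _ _).trans (transport_self w')
  conv_rhs => rw [← h₂]
  refine le_str_transport le_rfl ((str_le_base_str _).trans ?_)
  rw [map_hom_transport]
  exact (hb _).trans_eq (congrArg Y.str hw')

variable (A)

/-- The representatives of the transport orbits: the elements of the algebra that lie over the
points `s z` of `Y`. This is a structure and not a subtype, as a subtype would inherit the order of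
the algebra in place of `DescentLE`. -/
@[ext]
structure DescentPoint where
  val : A.A.left.carrier
  normal : s (f.map (A.A.hom.map val)) = A.A.hom.map val

/-- The preorder `DescentLE` on the representatives. -/
abbrev descentPreorder : Preorder (DescentPoint A s) where
  le w w' := DescentLE A w.val w'.val
  le_refl _ := descentLE_of_le le_rfl
  le_trans _ _ _ e e' := e.trans hf e'

/-- The object of `Ord // X` formed by the representatives, with the restricted structure map. -/
def descentObj : LaxComma X :=
  letI := descentPreorder A hf s
  { carrier := DescentPoint A s
    str :=
      { toFun := fun w => A.A.left.str w.val
        monotone' := fun _ w' e => DescentLE.str_le hf s hb e w'.normal } }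

/-- The morphism to the base, the restriction of `f ∘ p`. -/
def descentHom : descentObj A hf s hb ⟶ Z where
  map :=
    { toFun := fun w => f.map (A.A.hom.map w.val)
      monotone' := fun _ _ e => DescentLE.map_le e }
  str_le w := str_le_base_str w.val

/-- The object over `Z` to which the algebra descends. -/
def descentOver : Over Z := Over.mk (descentHom A hf s hb)

/-- The quotient map `w ↦ θ(w, s (f (p w)))` onto the descended object. -/
noncomputable def descentProj : A.A.left ⟶ descentObj A hf s hb where
  map :=
    { toFun := fun w => ⟨transport A w (s (f.map (A.A.hom.map w))) (hs _).symm, by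
        rw [map_hom_transport, hom_transport]⟩
      monotone' := fun w w' e => show DescentLE A _ _ from
        ⟨A.A.hom.map w, A.A.hom.map w', map_hom_transport .., map_hom_transport .., by
          rw [transport_transport, transport_transport, transport_self, transport_self]
          exact e⟩ }
  str_le w := le_str_transport le_rfl ((str_le_base_str w).trans (hb _))

theorem descentProj_condition :
    descentProj A hf s hs hb ≫ descentHom A hf s hb = A.A.hom ≫ f :=
  hom_ext fun w => map_hom_transport A w _ _

/-- The morphism `(w, y) ↦ θ(w, y)` from the pullback of the descended object. -/
noncomputable def descentTransport : pullback (descentHom A hf s hb) f ⟶ A.A.left where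
  map :=
    { toFun := fun p => transport A ((pullback.fst (descentHom A hf s hb) f).map p).val
        ((pullback.snd (descentHom A hf s hb) f).map p) (map_fst_eq_map_snd p)
      monotone' := fun _ _ e => DescentLE.transport_le
        (hom_mono (pullback.fst (descentHom A hf s hb) f) e) (hom_mono _ e) _ _ }
  str_le p := le_str_transport
    (hom_str_le (pullback.fst (descentHom A hf s hb) f) p) (hom_str_le _ p)

/-- The descended object pulls back to the algebra. -/
noncomputable def descentIso : pullback (descentHom A hf s hb) f ≅ A.A.left where
  hom := descentTransport A hf s hb
  inv := pullback.lift (descentProj A hf s hs hb) A.A.hom (descentProj_condition A hf s hs hb)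
  hom_inv_id := by
    refine pullback.hom_ext ?_ ?_
    · rw [Category.assoc, pullback.lift_fst, Category.id_comp]
      refine hom_ext fun p => DescentPoint.ext ?_
      refine (transport_transport _ _ _ _ _).trans ((transport_congr rfl ?_).trans
        (transport_self _))
      refine Eq.trans ?_ ((pullback.fst (descentHom A hf s hb) f).map p).normal
      exact congrArg s (map_hom_transport A _ _ _)
    · rw [Category.assoc, pullback.lift_snd, Category.id_comp]
      exact hom_ext fun p => hom_transport _ _ _
  inv_hom_id := hom_ext fun w =>
    (transport_congr
        (congrArg DescentPoint.val (congr_map (pullback.lift_fst (descentProj A hf s hs hb) A.A.hom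
          (descentProj_condition A hf s hs hb)) w))
        (congr_map (pullback.lift_snd _ _ (descentProj_condition A hf s hs hb)) w)
        (h' := map_hom_transport A w _ _)).trans
      ((transport_transport _ _ _ _ _).trans (transport_self w))

/-- The comparison functor sends the descended object to the given algebra. -/
noncomputable def comparisonDescentIso :
    (Monad.comparison (Over.mapPullbackAdj f)).obj (descentOver A hf s hb) ≅ A :=
  Monad.Algebra.isoMk
    (Over.isoMk (descentIso A hf s hs hb) (hom_ext fun p => hom_transport _ _ _))
    (algebraHom_condition _ fun p y h => by
      refine (congrArg (descentTransport A hf s hb).map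
        (transport_comparison (descentOver A hf s hb) p y h)).trans ?_
      refine (transport_congr (congrArg DescentPoint.val (fst_pullbackMk _ _ _))
        (snd_pullbackMk _ _ _) (h' := (map_fst_eq_map_snd p).trans h)).trans ?_
      exact (transport_transport _ _ _ _ _).symm)

end Descent

end LaxComma

theorem mainTheorem3 {X : Type u} [Preorder X] [CompleteHeytingPreorder X]
    {Y Z : LaxComma X} (f : Y ⟶ Z)
    (hf : ∀ z₀ z₁ z₂ : Z.carrier, z₀ ≤ z₁ → z₁ ≤ z₂ →
      ∃ y₀ y₁ y₂ : Y.carrier, y₀ ≤ y₁ ∧ y₁ ≤ y₂ ∧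
        f.map y₀ = z₀ ∧ f.map y₁ = z₁ ∧ f.map y₂ = z₂ ∧
        AntisymmRel (· ≤ ·) (Y.str y₀) (Z.str z₀)) :
    IsEffectiveDescent f := by
  obtain ⟨s, hs, hb⟩ := LaxComma.LiftsChains.exists_section hf
  exact
    { faithful := LaxComma.comparison_faithful hf
      full := LaxComma.comparison_full hf
      essSurj := ⟨fun A => ⟨_, ⟨LaxComma.comparisonDescentIso A hf s hs hb⟩⟩⟩ }
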